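/- Let $s\ge 1$, $p\ge 2s+1$, $s\le r\le p-(s+1)$ and $k\ge 0$ be integers. Let $\mathcal S^{p,r}_h([0,1])$, $h=\frac1{k+1}$, be the space of $C^r$ functions on $[0,1]$ that are polynomials of degree at most $p$ on each interval $[jh,(j+1)h]$, $0\le j\le k$, and let $\mathcal S=\mathcal S^{p,r}_h([0,1])\otimes\mathcal S^{p,r}_h([0,1])$ be the tensor-product spline space on $[0,1]^2$. Let $\overline\Omega=\overline{\Omega^{(i_0)}}\cup\overline{\Omega^{(i_1)}}\subset\mathbb R^2$ be a bilinearly parameterized two-patch domain: $\overline{\Omega^{(\tau)}}=\mathbf F^{(\tau)}([0,1]^2)$, $\tau\in\{i_0,i_1\}$, where each $\mathbf F^{(\tau)}$ is bilinear, injective on $[0,1]^2$ and regular (its Jacobian determinant vanishes nowhere on $[0,1]^2$), the open patches $\Omega^{(\tau)}=\mathbf F^{(\tau)}((0,1)^2)$ are disjoint, $\mathbf F^{(i_0)}(0,\xi)=\mathbf F^{(i_1)}(0,\xi)$ for $\xi\in[0,1]$, and $\overline{\Omega^{(i_0)}}\cap\overline{\Omega^{(i_1)}}$ is exactly this common edge.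 Put $$\alpha^{(\tau)}(\xi)=\lambda\det\bigl(\partial_1\mathbf F^{(\tau)}(0,\xi),\partial_2\mathbf F^{(\tau)}(0,\xi)\bigr),\qquad \beta^{(\tau)}(\xi)=\frac{\partial_1\mathbf F^{(\tau)}(0,\xi)\cdot\partial_2\mathbf F^{(\tau)}(0,\xi)}{\|\partial_2\mathbf F^{(\tau)}(0,\xi)\|^2},$$ where $\lambda\in\mathbb R$ minimizes $\|\alpha^{(i_0)}+1\|_{L^2(0,1)}^2+\|\alpha^{(i_1)}-1\|_{L^2(0,1)}^2$. Let $\mathcal V$ be the space of all $\phi\in L^2(\overline\Omega)$ with $\phi|_{\overline{\Omega^{(\tau)}}}\in\mathcal S\circ(\mathbf F^{(\tau)})^{-1}$ for $\tau\in\{i_0,i_1\}$ (as elements of $L^2$), and $\mathcal V^s=\mathcal V\cap C^s(\overline\Omega)$. Then $\phi\in\mathcal V$ belongs to $\mathcal V^s$ if and only if the spline functions $f^{(\tau)}=\phi\circ\mathbf F^{(\tau)}\in\mathcal S$ satisfy, on $[0,1]$, $$f_\ell^{(i_0)}(\xi)=f_\ell^{(i_1)}(\xi)=:f_\ell(\xi),\qquad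 \ell=0,1,\dots,s,$$ where, recursively in $\ell$, $$f_\ell^{(\tau)}(\xi)=\bigl(\alpha^{(\tau)}(\xi)\bigr)^{-\ell}\,\partial_1^\ell f^{(\tau)}(0,\xi)-\sum_{i=0}^{\ell-1}\binom{\ell}{i}\left(\frac{\beta^{(\tau)}(\xi)}{\alpha^{(\tau)}(\xi)}\right)^{\ell-i}\partial^{\ell-i}f_i(\xi),\qquad \tau\in\{i_0,i_1\}.$$ -/

import Mathlib

open Set MeasureTheory

noncomputable section

namespace Isogeometric

/-- The Euclidean plane. -/
abbrev Plane : Type := EuclideanSpace ℝ (Fin 2)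

/-- The closed parameter square `[0,1]²`. -/
def unitSquare : Set (ℝ × ℝ) := Icc 0 1 ×ˢ Icc 0 1

/-- The open parameter square `(0,1)²`. -/
def openSquare : Set (ℝ × ℝ) := Ioo 0 1 ×ˢ Ioo 0 1

/-- The determinant of the `2 × 2` matrix with columns `u`, `v`. -/
def det2 (u v : Plane) : ℝ := u 0 * v 1 - u 1 * v 0

/-- The bilinear map that sends the vertex `(a, b)` of the unit square to `P a b`. -/
def bilinearMap (P : Fin 2 → Fin 2 → Plane) (ξ : ℝ × ℝ) : Plane :=
  ((1 - ξ.1) * (1 - ξ.2)) • P 0 0 + (ξ.1 * (1 - ξ.2)) • P 1 0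
    + ((1 - ξ.1) * ξ.2) • P 0 1 + (ξ.1 * ξ.2) • P 1 1

/-- The partial derivative `∂₁F(ξ)`. -/
def partialFst (F : ℝ × ℝ → Plane) (ξ : ℝ × ℝ) : Plane := deriv (fun t => F (t, ξ.2)) ξ.1

/-- The partial derivative `∂₂F(ξ)`. -/
def partialSnd (F : ℝ × ℝ → Plane) (ξ : ℝ × ℝ) : Plane := deriv (fun t => F (ξ.1, t)) ξ.2

/-- A bilinearly parameterized planar two-patch domain. The two patches (indexed by `0` and `1`)
are disjoint quadrangles with bilinear, bijective and regular parameterizations; their closures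
share exactly one whole edge, which both maps parameterize in the same way by `t ↦ F (0, t)`. -/
structure TwoPatchDomain where
  /-- `corner τ a b` is the image of the vertex `(a, b)` of the unit square in patch `τ`. -/
  corner : Fin 2 → Fin 2 → Fin 2 → Plane
  regular : ∀ τ, ∀ ξ ∈ unitSquare,
    det2 (partialFst (bilinearMap (corner τ)) ξ) (partialSnd (bilinearMap (corner τ)) ξ) ≠ 0
  injOn : ∀ τ, InjOn (bilinearMap (corner τ)) unitSquare
  disjoint_patches :
    Disjoint (bilinearMap (corner 0) '' openSquare) (bilinearMap (corner 1) '' openSquare)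
  interface_eq : ∀ t ∈ Icc (0 : ℝ) 1, bilinearMap (corner 0) (0, t) = bilinearMap (corner 1) (0, t)
  inter_eq : bilinearMap (corner 0) '' unitSquare ∩ bilinearMap (corner 1) '' unitSquare
    = (fun t : ℝ => bilinearMap (corner 0) (0, t)) '' Icc 0 1

/-- The univariate spline space of degree `p`, regularity `r` and mesh size `1 / (k + 1)` on
`[0,1]`: the `C^r` functions that are polynomials of degree at most `p` on every mesh interval.
Only the values on `[0,1]` are constrained. -/
def splineSpace (p r k : ℕ) : Submodule ℝ (ℝ → ℝ) where
  carrier := {g | ContDiffOn ℝ r g (Icc 0 1) ∧ ∀ i : ℕ, i ≤ k →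
    ∃ q : Polynomial ℝ, q.degree ≤ p ∧
      ∀ x ∈ Icc ((i : ℝ) / (k + 1)) (((i : ℝ) + 1) / (k + 1)), g x = q.eval x}
  zero_mem' := ⟨contDiffOn_const, fun _ _ => ⟨0, by simp, by simp⟩⟩
  add_mem' := by
    rintro a b ⟨ha, ha'⟩ ⟨hb, hb'⟩
    refine ⟨ha.add hb, fun i hi => ?_⟩
    obtain ⟨q, hq, hqa⟩ := ha' i hi
    obtain ⟨u, hu, hub⟩ := hb' i hi
    exact ⟨q + u, (Polynomial.degree_add_le q u).trans (max_le hq hu),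
      fun x hx => by simp [hqa x hx, hub x hx]⟩
  smul_mem' := by
    rintro c a ⟨ha, ha'⟩
    refine ⟨contDiffOn_const.smul ha, fun i hi => ?_⟩
    obtain ⟨q, hq, hqa⟩ := ha' i hi
    exact ⟨c • q, (Polynomial.degree_smul_le c q).trans hq, fun x hx => by simp [hqa x hx]⟩

/-- The tensor-product spline space on `[0,1]²`: the span of the products `g(ξ₁) h(ξ₂)` of two
univariate splines. -/
def tensorSplineSpace (p r k : ℕ) : Submodule ℝ (ℝ × ℝ → ℝ) :=
  Submodule.span ℝ {f | ∃ g ∈ splineSpace p r k, ∃ h ∈ splineSpace p r k,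
    f = fun ξ => g ξ.1 * h ξ.2}

namespace TwoPatchDomain

variable (D : TwoPatchDomain)

/-- The geometry mapping of the patch `τ`. -/
def F (τ : Fin 2) : ℝ × ℝ → Plane := bilinearMap (D.corner τ)

/-- The closed patch `τ`. -/
def closedPatch (τ : Fin 2) : Set Plane := D.F τ '' unitSquare

/-- The closed two-patch domain, the union of the two closed patches. -/
def closedDomain : Set Plane := D.closedPatch 0 ∪ D.closedPatch 1

/-- The inverse of the geometry mapping of the patch `τ`, from the closed patch to `[0,1]²`. -/
def invF (τ : Fin 2) : Plane → ℝ × ℝ := Function.invFunOn (D.F τ) unitSquare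

/-- Square-integrable functions (modulo equality almost everywhere) on the closed domain. -/
abbrev L2 : Type := Lp ℝ 2 (volume.restrict D.closedDomain)

/-- `f` is a tensor-product spline and the restriction of `φ` to the closed patch `τ` is
`f ∘ F⁻¹`; in other words `f` is the spline function `φ ∘ F`. -/
def IsSplineOn (p r k : ℕ) (φ : D.L2) (τ : Fin 2) (f : ℝ × ℝ → ℝ) : Prop :=
  f ∈ tensorSplineSpace p r k ∧
    (φ : Plane → ℝ) =ᵐ[volume.restrict (D.closedPatch τ)] f ∘ D.invF τ

/-- The space of isogeometric functions. -/
def isogeometricSpace (p r k : ℕ) : Set D.L2 :=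
  {φ | ∀ τ, ∃ f, D.IsSplineOn p r k φ τ f}

/-- The isogeometric functions that are of class `C^s` on the closed domain. -/
def smoothIsogeometricSpace (p r k s : ℕ) : Set D.L2 :=
  {φ | φ ∈ D.isogeometricSpace p r k ∧ ∃ g : Plane → ℝ, ContDiffOn ℝ s g D.closedDomain ∧
    (φ : Plane → ℝ) =ᵐ[volume.restrict D.closedDomain] g}

/-- The gluing function `α`, scaled by `lam`. -/
def alpha (lam : ℝ) (τ : Fin 2) (ξ : ℝ) : ℝ :=
  lam * det2 (partialFst (D.F τ) (0, ξ)) (partialSnd (D.F τ) (0, ξ))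

/-- The gluing function `β`. -/
def beta (τ : Fin 2) (ξ : ℝ) : ℝ :=
  inner ℝ (partialFst (D.F τ) (0, ξ)) (partialSnd (D.F τ) (0, ξ))
    / ‖partialSnd (D.F τ) (0, ξ)‖ ^ 2

/-- `lam` minimizes `‖α⁽⁰⁾ + 1‖² + ‖α⁽¹⁾ - 1‖²` in `L²(0,1)`. -/
def IsGluingScale (lam : ℝ) : Prop :=
  IsMinOn (fun c : ℝ => (∫ ξ in (0 : ℝ)..1, (D.alpha c 0 ξ + 1) ^ 2)
    + ∫ ξ in (0 : ℝ)..1, (D.alpha c 1 ξ - 1) ^ 2) univ lam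

/-- The function `ξ ↦ α^{-ℓ} ∂₁^ℓ f(0,ξ) - ∑_{i<ℓ} (ℓ choose i) (β/α)^{ℓ-i} ∂^{ℓ-i} gᵢ(ξ)` on
`[0,1]` for the patch `τ`; derivatives at the ends of `[0,1]` are one-sided. -/
def interfaceFun (lam : ℝ) (τ : Fin 2) (f : ℝ × ℝ → ℝ) (g : ℕ → ℝ → ℝ) (l : ℕ) (ξ : ℝ) : ℝ :=
  D.alpha lam τ ξ ^ (-(l : ℤ)) * iteratedDerivWithin l (fun t => f (t, ξ)) (Icc 0 1) 0
    - ∑ i ∈ Finset.range l, (l.choose i : ℝ) * (D.beta τ ξ / D.alpha lam τ ξ) ^ (l - i)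
        * iteratedDerivWithin (l - i) (g i) (Icc 0 1) ξ

end TwoPatchDomain

end Isogeometric

end

noncomputable section

open Filter Topology

/-! ### Symmetry of iterated derivatives within a set -/

section SymmetricDerivatives

variable {E F : Type*} [NormedAddCommGroup E] [NormedSpace ℝ E] [NormedAddCommGroup F]
  [NormedSpace ℝ F]

/-! Write `G = f ∘ F⁻¹` on a closed patch, `e` for the direction of the common edge and `n` for its
suitably scaled normal. On the edge `∂₁F = α n + β e`, where `n` and `e` depend neither on the patch
nor on the point. Since `F` is affine in its first variable, `∂₁^ℓ f(0,ξ)` is exactly the value of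
`D^ℓ G` on `ℓ` copies of `α n + β e`. Symmetry of `D^ℓ G` expands it binomially into `α^ℓ ∑ (ℓ
choose i) (β/α)^(ℓ-i) D^ℓ G(e,…,e,n,…,n)` with `i` entries `n`, and each mixed term is the
`(ℓ-i)`-th derivative along the edge of the `i`-th normal derivative. The recursion subtracts all
terms with `i < ℓ`, so `f_ℓ` is the `ℓ`-th normal derivative of `G`
(`interfaceFun_eq_iteratedFDerivWithin`).

The condition thus says that the normal derivatives up to order `s` agree on the edge.
Differentiating along the edge gives all mixed derivatives, hence by symmetry the full jets
(`iteratedFDerivWithin_eq_of_normal_eq`), and functions on closed sets with matching jets glue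
(`contDiffOn_union_of_iteratedFDerivWithin_eq`). Conversely, a `C^s` function on the union has one
jet on the edge, seen from both patches.

Dividing by `α` requires `λ ≠ 0`; this holds because disjoint patches lie on opposite sides of the
edge (`det2_mul_det2_neg`, `IsGluingScale.ne_zero`). -/

theorem iteratedFDerivWithin_comp_swap_zero_one {G : E → F} {s : Set E} {m : ℕ} {x : E}
    (hG : ContDiffOn ℝ (m + 2 : ℕ) G s) (hs : UniqueDiffOn ℝ s) (hx : x ∈ s)
    (hcl : x ∈ closure (interior s)) (v : Fin (m + 2) → E) :
    iteratedFDerivWithin ℝ (m + 2) G s x (v ∘ Equiv.swap 0 1)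
      = iteratedFDerivWithin ℝ (m + 2) G s x v := by
  -- Reads `D^(m+2) G` as the second derivative of `D^m G`, so that exchanging the first two slots
  -- is the symmetry of a second derivative.
  have key : ∀ w : Fin (m + 2) → E, iteratedFDerivWithin ℝ (m + 2) G s x w
      = fderivWithin ℝ (fderivWithin ℝ (iteratedFDerivWithin ℝ m G s) s) s x (w 0) (w 1)
        (Fin.tail (Fin.tail w)) := by
    intro w
    have h := (continuousMultilinearCurryLeftEquiv ℝ
      (fun _ : Fin (m + 1) => E) F).symm.comp_fderivWithin
      (f := fderivWithin ℝ (iteratedFDerivWithin ℝ m G s) s) (hs x hx)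
    rw [iteratedFDerivWithin_succ_apply_left, iteratedFDerivWithin_succ_eq_comp_left]
    exact congrArg (fun L => L (w 0) (Fin.tail w)) h
  have hH : ContDiffOn ℝ (2 : ℕ) (iteratedFDerivWithin ℝ m G s) s := by
    intro y hy
    exact (hG y hy).iteratedFDerivWithin_right (m := (2 : ℕ)) (i := m) hs (by norm_cast; omega) hy
  have hsymm : IsSymmSndFDerivWithinAt ℝ (iteratedFDerivWithin ℝ m G s) s x :=
    ContDiffWithinAt.isSymmSndFDerivWithinAt (hH x hx)
      (by simp [minSmoothness_of_isRCLikeNormedField]) hs hcl hx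
  rw [key, key, hsymm.eq]
  congr 2

/-- The iterated derivatives of a `C^n` function are symmetric. -/
theorem iteratedFDerivWithin_comp_perm_of_contDiffOn {G : E → F} {s : Set E}
    (hs : UniqueDiffOn ℝ s) (hcl : s ⊆ closure (interior s)) (m : ℕ) :
    ContDiffOn ℝ m G s → ∀ x ∈ s, ∀ (v : Fin m → E) (σ : Equiv.Perm (Fin m)),
      iteratedFDerivWithin ℝ m G s x (v ∘ σ) = iteratedFDerivWithin ℝ m G s x v := by
  induction m with
  | zero => intro _ x _ v σ; congr 1; exact Subsingleton.elim _ _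
  | succ m ih =>
    intro hG x hx v σ
    replace ih := ih (hG.of_le (by norm_cast; omega))
    -- Adjacent transpositions generate all permutations.
    have hσ : σ ∈ Submonoid.closure (range fun i : Fin m => Equiv.swap i.castSucc i.succ) := by
      rw [Equiv.Perm.mclosure_swap_castSucc_succ]; trivial
    induction hσ using Submonoid.closure_induction generalizing v with
    | one => rfl
    | mul σ τ _ _ h1 h2 =>
      have : v ∘ (σ * τ : Equiv.Perm _) = (v ∘ σ) ∘ τ := rfl
      rw [this, h2, h1]
    | mem σ hσ =>
      obtain ⟨i, rfl⟩ := hσ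
      cases m with
      | zero => exact i.elim0
      | succ m =>
        induction i using Fin.cases with
        | zero => exact iteratedFDerivWithin_comp_swap_zero_one hG hs hx (hcl hx) v
        | succ i =>
          simp only [iteratedFDerivWithin_succ_apply_left (n := m + 1)]
          have h0 : (v ∘ Equiv.swap i.succ.castSucc i.succ.succ) 0 = v 0 := by
            simp only [Function.comp_apply]
            rw [Equiv.swap_apply_of_ne_of_ne]
            · intro h; simpa using congrArg Fin.val h
            · intro h; simpa using congrArg Fin.val h
          have h1 : Fin.tail (v ∘ Equiv.swap i.succ.castSucc i.succ.succ)
              = Fin.tail v ∘ Equiv.swap i.castSucc i.succ := by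
            ext k
            simp only [Fin.tail, Function.comp_apply]
            congr 1
            rw [← Fin.succ_castSucc, Fin.succ_injective _ |>.swap_apply]
          rw [h0, h1]
          -- A transposition that fixes slot `0` acts on the last `m + 1` slots only. There the
          -- induction hypothesis is an identity between functions on `s`, to be differentiated in
          -- the direction `v 0`.
          have hd := (hG.differentiableOn_iteratedFDerivWithin (m := m + 1)
            (by norm_cast; omega) hs x hx).hasFDerivWithinAt
          have e1 := (hd.continuousMultilinear_apply_const
            (Fin.tail v ∘ Equiv.swap i.castSucc i.succ)).congr
            (f₁ := fun y => iteratedFDerivWithin ℝ (m + 1) G s y (Fin.tail v))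
            (fun y hy => (ih y hy _ _).symm) (ih x hx _ _).symm
          have e2 := hd.continuousMultilinear_apply_const (Fin.tail v)
          have := (hs x hx).eq e1 e2
          exact congrArg (fun L => L (v 0)) this

end SymmetricDerivatives

/-! ### Symmetric multilinear forms on two directions -/

section MixedDirections

variable {E : Type*}

/-- The `m`-tuple of directions `(e, …, e, n, …, n)` with `i` entries `n` at the end. -/
def mixedDirections (e n : E) (m i : ℕ) : Fin m → E := fun k => if (k : ℕ) + i < m then e else n

theorem mixedDirections_self (e n : E) (m : ℕ) : mixedDirections e n m m = fun _ => n := by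
  ext k; simp [mixedDirections]

theorem mixedDirections_zero (e n : E) (m : ℕ) : mixedDirections e n m 0 = fun _ => e := by
  ext k; simp [mixedDirections]

theorem cons_mixedDirections (e n : E) {m i : ℕ} (h : i ≤ m) :
    (Fin.cons e (mixedDirections e n m i) : Fin (m + 1) → E) = mixedDirections e n (m + 1) i := by
  ext k
  induction k using Fin.cases with
  | zero => simp [mixedDirections]; omega
  | succ k => simp only [mixedDirections, Fin.cons_succ, Fin.val_succ]; congr 1; simp; omega

theorem exists_perm_piecewise_eq_mixedDirections (e n : E) {m : ℕ} (s : Finset (Fin m)) :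
    ∃ σ : Equiv.Perm (Fin m),
      s.piecewise (fun _ => n) (fun _ => e) = mixedDirections e n m s.card ∘ σ := by
  have hc : s.card ≤ m := by simpa using s.card_le_univ
  -- The set `s` and the last `s.card` positions are equinumerous; a bijection between them extends
  -- to a permutation.
  have hcard : Fintype.card {k // k ∈ s} = Fintype.card {k : Fin m // ¬ (k : ℕ) + s.card < m} := by
    rw [Fintype.card_coe, Fintype.card_subtype_compl, Fintype.card_fin, Fintype.card_subtype]
    have : (Finset.univ.filter fun k : Fin m => (k : ℕ) + s.card < m)
        = Finset.univ.filter fun k : Fin m => (k : ℕ) < m - s.card := by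
      ext k; simp; omega
    rw [this, Fin.card_filter_val_lt]
    omega
  refine ⟨(Fintype.equivOfCardEq hcard).extendSubtype, ?_⟩
  ext k
  by_cases hk : k ∈ s
  · have := (Fintype.equivOfCardEq hcard).extendSubtype_mem k hk
    simp [hk, mixedDirections, this]
  · have := (Fintype.equivOfCardEq hcard).extendSubtype_not_mem k hk
    simp only [not_not] at this
    simp [hk, mixedDirections, this]

variable [NormedAddCommGroup E] [NormedSpace ℝ E]

theorem map_piecewise_of_symmetric {m : ℕ} {f : E [×m]→L[ℝ] ℝ}
    (hf : ∀ (v : Fin m → E) (σ : Equiv.Perm (Fin m)), f (v ∘ σ) = f v) (e n : E)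
    (s : Finset (Fin m)) :
    f (s.piecewise (fun _ => n) (fun _ => e)) = f (mixedDirections e n m s.card) := by
  obtain ⟨σ, hσ⟩ := exists_perm_piecewise_eq_mixedDirections e n s
  rw [hσ, hf]

/-- The binomial expansion of the diagonal values of a symmetric multilinear form. -/
theorem map_add_smul_of_symmetric {m : ℕ} {f : E [×m]→L[ℝ] ℝ}
    (hf : ∀ (v : Fin m → E) (σ : Equiv.Perm (Fin m)), f (v ∘ σ) = f v) (e n : E) (b : ℝ) :
    f (fun _ => n + b • e)
      = ∑ i ∈ Finset.range (m + 1),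
          (m.choose i : ℝ) * b ^ (m - i) * f (mixedDirections e n m i) := by
  have h1 : f (fun _ => n + b • e) = ∑ s : Finset (Fin m),
      b ^ (m - s.card) * f (mixedDirections e n m s.card) := by
    have := f.map_add_univ (fun _ => n) (fun _ => b • e)
    refine this.trans (Finset.sum_congr rfl fun s _ => ?_)
    have h2 : s.piecewise (fun _ => n) (fun _ => b • e)
        = fun k => (s.piecewise (fun _ => (1 : ℝ)) (fun _ => b) k) •
            (s.piecewise (fun _ => n) (fun _ => e) k) := by
      ext k; by_cases hk : k ∈ s <;> simp [hk]
    rw [h2, f.map_smul_univ, map_piecewise_of_symmetric hf, Finset.prod_piecewise]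
    simp [Finset.card_sdiff_of_subset]
  -- Grouping the subsets by cardinality produces the binomial coefficients.
  rw [h1, ← Finset.powerset_univ,
    Finset.sum_powerset_apply_card (fun c => b ^ (m - c) * f (mixedDirections e n m c))]
  simp [mul_assoc]

/-- A multilinear form is determined by its values on tuples of basis vectors, and symmetry sorts
each such tuple. -/
theorem eq_of_symmetric_of_mixedDirections {m : ℕ} {f g : E [×m]→L[ℝ] ℝ}
    (hf : ∀ (v : Fin m → E) (σ : Equiv.Perm (Fin m)), f (v ∘ σ) = f v)
    (hg : ∀ (v : Fin m → E) (σ : Equiv.Perm (Fin m)), g (v ∘ σ) = g v)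
    (b : Module.Basis (Fin 2) ℝ E)
    (h : ∀ i ≤ m, f (mixedDirections (b 0) (b 1) m i) = g (mixedDirections (b 0) (b 1) m i)) :
    f = g := by
  apply ContinuousMultilinearMap.toMultilinearMap_injective
  refine Module.Basis.ext_multilinear (fun _ => b) fun v => ?_
  have : (fun k => b (v k))
      = (Finset.univ.filter fun k => v k = 1).piecewise (fun _ => b 1) (fun _ => b 0) := by
    ext1 k
    by_cases hk : v k = 1
    · simp [hk]
    · have : v k = 0 := by omega
      simp [this]
  rw [this]
  change f _ = g _
  rw [map_piecewise_of_symmetric hf, map_piecewise_of_symmetric hg]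
  exact h _ (by simpa using (Finset.univ.filter fun k => v k = 1).card_le_univ)

end MixedDirections

/-! ### Derivatives along a segment -/

section AlongSegment

variable {E : Type*} [NormedAddCommGroup E] [NormedSpace ℝ E]

theorem hasDerivWithinAt_iteratedFDerivWithin_along {G : E → ℝ} {P : Set E} {m : ℕ}
    (hG : ContDiffOn ℝ (m + 1 : ℕ) G P) (hP : UniqueDiffOn ℝ P) {x e : E}
    (hline : ∀ t ∈ Icc (0 : ℝ) 1, x + t • e ∈ P) (w : Fin m → E) {t : ℝ} (ht : t ∈ Icc (0 : ℝ) 1) :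
    HasDerivWithinAt (fun t : ℝ => iteratedFDerivWithin ℝ m G P (x + t • e) w)
      (iteratedFDerivWithin ℝ (m + 1) G P (x + t • e) (Fin.cons e w)) (Icc 0 1) t := by
  have hd := ((hG.differentiableOn_iteratedFDerivWithin (m := m) (by norm_cast; omega) hP _
    (hline t ht)).hasFDerivWithinAt).continuousMultilinear_apply_const w
  have hl : HasDerivWithinAt (fun t : ℝ => x + t • e) e (Icc 0 1) t := by
    simpa using (((hasDerivAt_id t).smul_const e).const_add x).hasDerivWithinAt
  have := hd.comp_hasDerivWithinAt t hl hline
  exact this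

/-- Each derivative along the segment adds one slot filled with `e` in front. -/
theorem iteratedDerivWithin_iteratedFDerivWithin_along {G : E → ℝ} {P : Set E} {x e n : E} {i j : ℕ}
    (hG : ContDiffOn ℝ (i + j : ℕ) G P) (hP : UniqueDiffOn ℝ P)
    (hline : ∀ t ∈ Icc (0 : ℝ) 1, x + t • e ∈ P) {t : ℝ} (ht : t ∈ Icc (0 : ℝ) 1) :
    iteratedDerivWithin j (fun t : ℝ => iteratedFDerivWithin ℝ i G P (x + t • e) fun _ => n)
      (Icc 0 1) t
      = iteratedFDerivWithin ℝ (i + j) G P (x + t • e) (mixedDirections e n (i + j) i) := by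
  induction j generalizing t with
  | zero => simp [mixedDirections_self]
  | succ j ih =>
    replace ih := fun {t} => ih (t := t) (hG.of_le (by norm_cast; omega))
    rw [iteratedDerivWithin_succ, derivWithin_congr (fun u hu => ih hu) (ih ht),
      (hasDerivWithinAt_iteratedFDerivWithin_along (m := i + j) hG hP hline _ ht).derivWithin
        (uniqueDiffOn_Icc zero_lt_one t ht), cons_mixedDirections e n (by omega)]
    rfl

theorem iteratedDerivWithin_along {G : E → ℝ} {P : Set E} {x e : E} {l : ℕ}
    (hG : ContDiffOn ℝ l G P) (hP : UniqueDiffOn ℝ P)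
    (hline : ∀ t ∈ Icc (0 : ℝ) 1, x + t • e ∈ P) {t : ℝ} (ht : t ∈ Icc (0 : ℝ) 1) :
    iteratedDerivWithin l (fun t : ℝ => G (x + t • e)) (Icc 0 1) t
      = iteratedFDerivWithin ℝ l G P (x + t • e) fun _ => e := by
  have := iteratedDerivWithin_iteratedFDerivWithin_along (i := 0) (j := l) (n := e)
    (by simpa using hG) hP hline ht
  simp only [iteratedFDerivWithin_zero_apply, mixedDirections_zero] at this
  have hcast : ∀ k, k = l → iteratedFDerivWithin ℝ k G P (x + t • e) (fun _ => e)
      = iteratedFDerivWithin ℝ l G P (x + t • e) fun _ => e := by rintro _ rfl; rfl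
  rw [this, hcast _ (zero_add l)]

end AlongSegment

/-! ### Gluing smooth functions on closed sets -/

section Gluing

variable {E F : Type*} [NormedAddCommGroup E] [NormedSpace ℝ E] [NormedAddCommGroup F]
  [NormedSpace ℝ F]

/-- Two `C^n` functions on closed sets glue to a `C^n` function on the union as soon as their
derivatives up to order `n` agree on the intersection. -/
theorem contDiffOn_union_of_iteratedFDerivWithin_eq {A B : Set E} {n : ℕ} {g : E → F}
    (hA : IsClosed A) (hB : IsClosed B) (uA : UniqueDiffOn ℝ A) (uB : UniqueDiffOn ℝ B)
    (gA : ContDiffOn ℝ n g A) (gB : ContDiffOn ℝ n g B)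
    (h : ∀ m ≤ n, ∀ x ∈ A ∩ B,
      iteratedFDerivWithin ℝ m g A x = iteratedFDerivWithin ℝ m g B x) :
    ContDiffOn ℝ n g (A ∪ B) := by
  classical
  -- A single candidate Taylor series: agreement on `A ∩ B` makes it, up to order `n`, that of `g`
  -- within `B` on all of `B`.
  let p : E → FormalMultilinearSeries ℝ E F := fun x =>
    if x ∈ A then ftaylorSeriesWithin ℝ g A x else ftaylorSeriesWithin ℝ g B x
  have pA : ∀ (m : ℕ), ∀ x ∈ A, p x m = ftaylorSeriesWithin ℝ g A x m := fun m x hx => by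
    simp only [p, if_pos hx]
  have pB : ∀ m ≤ n, ∀ x ∈ B, p x m = ftaylorSeriesWithin ℝ g B x m := fun m hm x hx => by
    by_cases hxA : x ∈ A
    · rw [pA m x hxA]; exact h m hm x ⟨hxA, hx⟩
    · simp only [p, if_neg hxA]
  have tA := gA.ftaylorSeriesWithin uA
  have tB := gB.ftaylorSeriesWithin uB
  have hp : HasFTaylorSeriesUpToOn n g p (A ∪ B) := by
    refine ⟨?_, ?_, ?_⟩
    · rintro x (hx | hx)
      · rw [pA 0 x hx]; exact tA.zero_eq x hx
      · rw [pB 0 (Nat.zero_le n) x hx]; exact tB.zero_eq x hx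
    · intro m hm x _
      have hm' : m < n := by exact_mod_cast hm
      have dA : HasFDerivWithinAt (p · m) (p x m.succ).curryLeft A x := by
        by_cases hx : x ∈ A
        · rw [pA _ x hx]
          exact (tA.fderivWithin m hm x hx).congr (fun y hy => pA m y hy) (pA m x hx)
        -- Away from the closed set `A`, differentiability within `A` is vacuous.
        · exact HasFDerivWithinAt.of_notMem_closure (by rwa [hA.closure_eq])
      have dB : HasFDerivWithinAt (p · m) (p x m.succ).curryLeft B x := by
        by_cases hx : x ∈ B
        · rw [pB _ hm' x hx]
          exact (tB.fderivWithin m hm x hx).congr (fun y hy => pB m hm'.le y hy) (pB m hm'.le x hx)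
        · exact HasFDerivWithinAt.of_notMem_closure (by rwa [hB.closure_eq])
      exact dA.union dB
    · intro m hm
      have hm' : m ≤ n := by exact_mod_cast hm
      exact ((tA.cont m hm).congr fun y hy => pA m y hy).union_of_isClosed
        ((tB.cont m hm).congr fun y hy => pB m hm' y hy) hA hB
  exact hp.contDiffOn

/-- The Taylor series on `S` restricts to one on `A`, where unique differentiability leaves no
other. -/
theorem iteratedFDerivWithin_eq_of_contDiffOn_superset {A S : Set E} {n m : ℕ} {g : E → F}
    (uA : UniqueDiffOn ℝ A) (uS : UniqueDiffOn ℝ S) (hAS : A ⊆ S) (hg : ContDiffOn ℝ n g S)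
    (hm : m ≤ n) {x : E} (hx : x ∈ A) :
    iteratedFDerivWithin ℝ m g A x = iteratedFDerivWithin ℝ m g S x :=
  ((((hg.ftaylorSeriesWithin uS).mono hAS).eq_iteratedFDerivWithin_of_uniqueDiffOn
    (by exact_mod_cast hm) uA hx)).symm

end Gluing

/-! ### Bilinear maps and splines on the square -/

namespace Isogeometric

theorem bilinearMap_eq_add_smul (P : Fin 2 → Fin 2 → Plane) (u v : ℝ) :
    bilinearMap P (u, v) = (P 0 0 + v • (P 0 1 - P 0 0))
      + u • ((1 - v) • (P 1 0 - P 0 0) + v • (P 1 1 - P 0 1)) := by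
  simp only [bilinearMap]; module

theorem partialFst_bilinearMap (P : Fin 2 → Fin 2 → Plane) (ξ : ℝ × ℝ) :
    partialFst (bilinearMap P) ξ = (1 - ξ.2) • (P 1 0 - P 0 0) + ξ.2 • (P 1 1 - P 0 1) := by
  simp only [partialFst, bilinearMap_eq_add_smul]
  exact (((hasDerivAt_id ξ.1).smul_const _).const_add _).deriv.trans (one_smul _ _)

theorem bilinearMap_eq_add_smul_partialFst (P : Fin 2 → Fin 2 → Plane) (u v : ℝ) :
    bilinearMap P (u, v) = (P 0 0 + v • (P 0 1 - P 0 0))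
      + u • partialFst (bilinearMap P) (0, v) := by
  rw [partialFst_bilinearMap, bilinearMap_eq_add_smul]

theorem partialSnd_bilinearMap (P : Fin 2 → Fin 2 → Plane) (ξ : ℝ × ℝ) :
    partialSnd (bilinearMap P) ξ = (1 - ξ.1) • (P 0 1 - P 0 0) + ξ.1 • (P 1 1 - P 1 0) := by
  have : ∀ t, bilinearMap P (ξ.1, t) = (P 0 0 + ξ.1 • (P 1 0 - P 0 0))
      + t • ((1 - ξ.1) • (P 0 1 - P 0 0) + ξ.1 • (P 1 1 - P 1 0)) := fun t => by
    simp only [bilinearMap]; module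
  simp only [partialSnd, this]
  exact (((hasDerivAt_id ξ.2).smul_const _).const_add _).deriv.trans (one_smul _ _)

theorem contDiff_bilinearMap (P : Fin 2 → Fin 2 → Plane) {n : WithTop ℕ∞} :
    ContDiff ℝ n (bilinearMap P) := by
  unfold bilinearMap; fun_prop

theorem fderiv_bilinearMap_apply (P : Fin 2 → Fin 2 → Plane) (ξ : ℝ × ℝ) (a b : ℝ) :
    fderiv ℝ (bilinearMap P) ξ (a, b)
      = a • partialFst (bilinearMap P) ξ + b • partialSnd (bilinearMap P) ξ := by
  have hF := ((contDiff_bilinearMap P (n := 1)).differentiable one_ne_zero ξ).hasFDerivAt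
  have h1 : partialFst (bilinearMap P) ξ = fderiv ℝ (bilinearMap P) ξ (1, 0) :=
    (HasFDerivAt.comp_hasDerivAt (f := fun t : ℝ => (t, ξ.2)) ξ.1 hF
      ((hasDerivAt_id ξ.1).prodMk (hasDerivAt_const ξ.1 ξ.2))).deriv
  have h2 : partialSnd (bilinearMap P) ξ = fderiv ℝ (bilinearMap P) ξ (0, 1) :=
    (HasFDerivAt.comp_hasDerivAt (f := fun t : ℝ => (ξ.1, t)) ξ.2 hF
      ((hasDerivAt_const ξ.2 ξ.1).prodMk (hasDerivAt_id ξ.2))).deriv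
  rw [h1, h2, ← map_smul, ← map_smul, ← map_add]
  simp

theorem det2_smul_add_smul (a b : ℝ) (u v : Plane) :
    det2 (a • u + b • v) v = a * det2 u v := by
  simp [det2]; ring

theorem eq_zero_of_smul_add_smul_eq_zero {u v : Plane} (h : det2 u v ≠ 0) {a b : ℝ}
    (hab : a • u + b • v = 0) : a = 0 ∧ b = 0 := by
  have h0 : a * u 0 + b * v 0 = 0 := by simpa using congrArg (fun w : Plane => w 0) hab
  have h1 : a * u 1 + b * v 1 = 0 := by simpa using congrArg (fun w : Plane => w 1) hab
  constructor
  · refine (mul_eq_zero.1 ?_).resolve_right h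
    simp only [det2]; linear_combination v 1 * h0 - v 0 * h1
  · refine (mul_eq_zero.1 ?_).resolve_right h
    simp only [det2]; linear_combination -u 1 * h0 + u 0 * h1

theorem exists_equiv_hasFDerivAt_bilinearMap (P : Fin 2 → Fin 2 → Plane) (ξ : ℝ × ℝ)
    (h : det2 (partialFst (bilinearMap P) ξ) (partialSnd (bilinearMap P) ξ) ≠ 0) :
    ∃ f' : (ℝ × ℝ) ≃L[ℝ] Plane, HasFDerivAt (bilinearMap P) (f' : (ℝ × ℝ) →L[ℝ] Plane) ξ ∧
      ∀ a b, f' (a, b) = a • partialFst (bilinearMap P) ξ + b • partialSnd (bilinearMap P) ξ := by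
  have hinj : Function.Injective (fderiv ℝ (bilinearMap P) ξ).toLinearMap := by
    rw [← LinearMap.ker_eq_bot, LinearMap.ker_eq_bot']
    rintro ⟨a, b⟩ hab
    have := eq_zero_of_smul_add_smul_eq_zero h ((fderiv_bilinearMap_apply P ξ a b).symm.trans hab)
    simp [this.1, this.2]
  have hfin : Module.finrank ℝ (ℝ × ℝ) = Module.finrank ℝ Plane := by simp
  let f' := (LinearEquiv.ofInjectiveOfFinrankEq _ hinj hfin).toContinuousLinearEquiv
  have hf' : (f' : (ℝ × ℝ) →L[ℝ] Plane) = fderiv ℝ (bilinearMap P) ξ := by ext <;> rfl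
  refine ⟨f', ?_, fun a b => ?_⟩
  · rw [hf']
    exact ((contDiff_bilinearMap P (n := 1)).differentiable one_ne_zero ξ).hasFDerivAt
  · rw [← fderiv_bilinearMap_apply, ← hf']; rfl

theorem isCompact_unitSquare : IsCompact unitSquare := isCompact_Icc.prod isCompact_Icc

theorem uniqueDiffOn_unitSquare : UniqueDiffOn ℝ unitSquare :=
  (uniqueDiffOn_Icc zero_lt_one).prod (uniqueDiffOn_Icc zero_lt_one)

theorem isOpen_openSquare : IsOpen openSquare := isOpen_Ioo.prod isOpen_Ioo

theorem openSquare_subset_unitSquare : openSquare ⊆ unitSquare :=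
  prod_mono Ioo_subset_Icc_self Ioo_subset_Icc_self

theorem closure_openSquare : closure openSquare = unitSquare := by
  rw [openSquare, closure_prod_eq, closure_Ioo zero_ne_one, unitSquare]

theorem contDiffOn_of_mem_tensorSplineSpace {p r k : ℕ} {f : ℝ × ℝ → ℝ}
    (hf : f ∈ tensorSplineSpace p r k) : ContDiffOn ℝ r f unitSquare := by
  induction hf using Submodule.span_induction with
  | mem f hf =>
    obtain ⟨g, hg, h, hh, rfl⟩ := hf
    exact (hg.1.comp contDiff_fst.contDiffOn fun x hx => hx.1).mul
      (hh.1.comp contDiff_snd.contDiffOn fun x hx => hx.2)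
  | zero => exact contDiffOn_const
  | add f g _ _ hf hg => exact hf.add hg
  | smul c f _ hf => exact contDiffOn_const.smul hf

/-! ### The patches and their inverse parameterizations -/

namespace TwoPatchDomain

variable (D : TwoPatchDomain) (τ : Fin 2)

theorem continuous_F : Continuous (D.F τ) := (contDiff_bilinearMap _ (n := 0)).continuous

theorem isCompact_closedPatch : IsCompact (D.closedPatch τ) :=
  isCompact_unitSquare.image (D.continuous_F τ)

theorem invF_F {ξ : ℝ × ℝ} (hξ : ξ ∈ unitSquare) : D.invF τ (D.F τ ξ) = ξ :=
  (D.injOn τ).leftInvOn_invFunOn hξ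

theorem invF_mem {y : Plane} (hy : y ∈ D.closedPatch τ) : D.invF τ y ∈ unitSquare :=
  Function.invFunOn_mem hy

theorem F_invF {y : Plane} (hy : y ∈ D.closedPatch τ) : D.F τ (D.invF τ y) = y :=
  Function.invFunOn_eq hy

theorem continuousOn_invF : ContinuousOn (D.invF τ) (D.closedPatch τ) := by
  rw [continuousOn_iff_isClosed]
  intro t ht
  refine ⟨D.F τ '' (t ∩ unitSquare),
    ((isCompact_unitSquare.inter_left ht).image (D.continuous_F τ)).isClosed, ?_⟩
  ext y
  constructor
  · rintro ⟨hy, hyP⟩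
    exact ⟨⟨D.invF τ y, ⟨hy, D.invF_mem τ hyP⟩, D.F_invF τ hyP⟩, hyP⟩
  · rintro ⟨⟨ξ, ⟨hξt, hξ⟩, rfl⟩, hyP⟩
    refine ⟨?_, hyP⟩
    rw [mem_preimage, D.invF_F τ hξ]
    exact hξt

theorem exists_equiv_hasFDerivAt_F {ξ : ℝ × ℝ} (hξ : ξ ∈ unitSquare) :
    ∃ f' : (ℝ × ℝ) ≃L[ℝ] Plane, HasFDerivAt (D.F τ) (f' : (ℝ × ℝ) →L[ℝ] Plane) ξ ∧
      ∀ a b, f' (a, b) = a • partialFst (D.F τ) ξ + b • partialSnd (D.F τ) ξ :=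
  exists_equiv_hasFDerivAt_bilinearMap _ ξ (D.regular τ ξ hξ)

theorem contDiffOn_invF {n : ℕ} : ContDiffOn ℝ n (D.invF τ) (D.closedPatch τ) := by
  rintro _ ⟨ξ, hξ, rfl⟩
  obtain ⟨f', hf', -⟩ := D.exists_equiv_hasFDerivAt_F τ hξ
  have hc : ContDiffAt ℝ (n + 1 : ℕ) (D.F τ) ξ := (contDiff_bilinearMap _).contDiffAt
  have hn : ((n + 1 : ℕ) : WithTop ℕ∞) ≠ 0 := by norm_cast
  have hloc := (hc.to_localInverse hf' hn).of_le (m := n) (by norm_cast; omega)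
  have hleft := (hc.hasStrictFDerivAt' hf' hn).eventually_left_inverse
  -- `invF` is a mere choice of preimages; its continuity keeps it near `ξ`, where it must coincide
  -- with the smooth local inverse.
  have htend : Tendsto (D.invF τ) (𝓝[D.closedPatch τ] (D.F τ ξ)) (𝓝 ξ) := by
    have := D.continuousOn_invF τ (D.F τ ξ) (mem_image_of_mem _ hξ)
    rwa [ContinuousWithinAt, D.invF_F τ hξ] at this
  refine hloc.contDiffWithinAt.congr_of_eventuallyEq ?_ ?_
  · filter_upwards [htend.eventually hleft, self_mem_nhdsWithin] with y hy hyP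
    rw [D.F_invF τ hyP] at hy
    exact hy.symm
  · rw [D.invF_F τ hξ]
    exact (hc.localInverse_apply_image hf' hn).symm

theorem uniqueDiffOn_closedPatch : UniqueDiffOn ℝ (D.closedPatch τ) := by
  rintro _ ⟨ξ, hξ, rfl⟩
  obtain ⟨f', hf', -⟩ := D.exists_equiv_hasFDerivAt_F τ hξ
  exact hf'.hasFDerivWithinAt.uniqueDiffWithinAt_of_continuousLinearEquiv f'
    (uniqueDiffOn_unitSquare ξ hξ)

theorem F_mem_interior_closedPatch {ξ : ℝ × ℝ} (hξ : ξ ∈ openSquare) :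
    D.F τ ξ ∈ interior (D.closedPatch τ) := by
  obtain ⟨f', hf', -⟩ := D.exists_equiv_hasFDerivAt_F τ (openSquare_subset_unitSquare hξ)
  have hc : ContDiffAt ℝ (1 : ℕ) (D.F τ) ξ := (contDiff_bilinearMap _).contDiffAt
  rw [mem_interior_iff_mem_nhds, ← (hc.hasStrictFDerivAt' hf' (by simp)).map_nhds_eq_of_equiv]
  exact image_mem_map (mem_of_superset (isOpen_openSquare.mem_nhds hξ)
    openSquare_subset_unitSquare)

theorem closedPatch_subset_closure_interior :
    D.closedPatch τ ⊆ closure (interior (D.closedPatch τ)) := by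
  rw [closedPatch, ← closure_openSquare]
  refine (image_closure_subset_closure_image (D.continuous_F τ)).trans (closure_mono ?_)
  rintro _ ⟨ξ, hξ, rfl⟩
  rw [closure_openSquare]
  exact D.F_mem_interior_closedPatch τ hξ

theorem contDiffOn_comp_invF {p r k : ℕ} {f : ℝ × ℝ → ℝ} (hf : f ∈ tensorSplineSpace p r k) :
    ContDiffOn ℝ r (f ∘ D.invF τ) (D.closedPatch τ) :=
  (contDiffOn_of_mem_tensorSplineSpace hf).comp (D.contDiffOn_invF τ) fun _ => D.invF_mem τ

/-! ### The common edge and the two sides of it -/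

theorem corner_zero_eq (b : Fin 2) : D.corner 1 0 b = D.corner 0 0 b := by
  have h0 := D.interface_eq 0 (by simp)
  have h1 := D.interface_eq 1 (by simp)
  simp only [bilinearMap] at h0 h1
  fin_cases b
  · simpa using h0.symm
  · simpa using h1.symm

/-- The direction vector of the common edge. -/
def edge : Plane := D.corner 0 0 1 - D.corner 0 0 0

theorem partialSnd_F_edge (ξ : ℝ) : partialSnd (D.F τ) (0, ξ) = D.edge := by
  rw [F, partialSnd_bilinearMap]
  fin_cases τ <;> simp [edge, corner_zero_eq]

theorem F_eq (u ξ : ℝ) :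
    D.F τ (u, ξ) = (D.corner 0 0 0 + ξ • D.edge) + u • partialFst (D.F τ) (0, ξ) := by
  rw [F, bilinearMap_eq_add_smul_partialFst]
  fin_cases τ <;> simp [edge, corner_zero_eq]

theorem F_zero (ξ : ℝ) : D.F τ (0, ξ) = D.corner 0 0 0 + ξ • D.edge := by
  simp [F_eq]

theorem det2_ne_zero {ξ : ℝ} (hξ : ξ ∈ Icc (0 : ℝ) 1) :
    det2 (partialFst (D.F τ) (0, ξ)) D.edge ≠ 0 := by
  have := D.regular τ (0, ξ) ⟨by simp, hξ⟩
  rwa [← F, partialSnd_F_edge] at this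

/-- If the signs agreed, the curve `u ↦ F 0 (u, ξ)`, which enters patch `0`, would also enter patch
`1`: its pullback by the local inverse of `F 1` has a first coordinate increasing from `0`. The open
patches would then meet. -/
theorem det2_mul_det2_neg {ξ : ℝ} (hξ : ξ ∈ Ioo (0 : ℝ) 1) :
    det2 (partialFst (D.F 0) (0, ξ)) D.edge * det2 (partialFst (D.F 1) (0, ξ)) D.edge < 0 := by
  have hξ' : ξ ∈ Icc (0 : ℝ) 1 := Ioo_subset_Icc_self hξ
  refine lt_of_le_of_ne (not_lt.1 fun hpos => ?_)
    (mul_ne_zero (D.det2_ne_zero 0 hξ') (D.det2_ne_zero 1 hξ'))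
  obtain ⟨f', hf', happ⟩ := D.exists_equiv_hasFDerivAt_F 1 (ξ := (0, ξ)) ⟨by simp, hξ'⟩
  have hst : HasStrictFDerivAt (D.F 1) (f' : (ℝ × ℝ) →L[ℝ] Plane) (0, ξ) :=
    (contDiff_bilinearMap (D.corner 1) (n := 1)).contDiffAt.hasStrictFDerivAt' hf' one_ne_zero
  set h := hst.localInverse with hh
  set d := partialFst (D.F 0) (0, ξ) with hd
  have hbase : D.F 1 (0, ξ) = D.F 0 (0, ξ) := by rw [F_zero, F_zero]
  have hγ : HasDerivAt (fun u : ℝ => D.F 0 (u, ξ)) d 0 := by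
    simp only [D.F_eq 0]
    simpa using ((hasDerivAt_id (0 : ℝ)).smul_const d).const_add (D.corner 0 0 0 + ξ • D.edge)
  have hinv : HasFDerivAt h (f'.symm : Plane →L[ℝ] ℝ × ℝ) (D.F 0 (0, ξ)) := by
    rw [← hbase]; exact hst.to_localInverse.hasFDerivAt
  have hcomp : HasDerivAt (fun u : ℝ => h (D.F 0 (u, ξ))) (f'.symm d) 0 :=
    HasFDerivAt.comp_hasDerivAt (f := fun u : ℝ => D.F 0 (u, ξ)) 0 hinv hγ
  have hzero : h (D.F 0 (0, ξ)) = (0, ξ) := by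
    rw [← hbase]; exact hst.localInverse_apply_image
  have hslope : 0 < (f'.symm d).1 := by
    -- Pairing this decomposition with the edge shows that the first coordinate of the velocity is
    -- the quotient of the two determinants.
    have h1 : d = (f'.symm d).1 • partialFst (D.F 1) (0, ξ) + (f'.symm d).2 • D.edge := by
      rw [← D.partialSnd_F_edge 1 ξ, ← happ]; simp
    rw [h1, det2_smul_add_smul, mul_assoc] at hpos
    exact pos_of_mul_pos_left hpos (mul_self_nonneg _)
  have hfst : HasDerivAt (fun u : ℝ => (h (D.F 0 (u, ξ))).1) (f'.symm d).1 0 := by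
    exact (ContinuousLinearMap.fst ℝ ℝ ℝ).hasFDerivAt.comp_hasDerivAt (0 : ℝ) hcomp
  have e1 : ∀ᶠ u in 𝓝[>] (0 : ℝ), 0 < (h (D.F 0 (u, ξ))).1 := by
    have := (hasDerivAt_iff_tendsto_slope.1 hfst).mono_left
      (nhdsWithin_mono _ fun u (hu : 0 < u) => hu.ne')
    filter_upwards [this.eventually (lt_mem_nhds hslope), self_mem_nhdsWithin] with u hu hu0
    rw [slope_def_field, hzero] at hu
    simpa [div_pos_iff_of_pos_right (show (0 : ℝ) < u from hu0)] using hu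
  have hcont : Tendsto (fun u : ℝ => h (D.F 0 (u, ξ))) (𝓝[>] 0) (𝓝 (0, ξ)) := by
    have := hcomp.continuousAt.tendsto
    rw [hzero] at this
    exact this.mono_left nhdsWithin_le_nhds
  have e2 : ∀ᶠ u in 𝓝[>] (0 : ℝ), h (D.F 0 (u, ξ)) ∈ Iio (1 : ℝ) ×ˢ Ioo (0 : ℝ) 1 :=
    hcont.eventually ((isOpen_Iio.prod isOpen_Ioo).mem_nhds ⟨zero_lt_one' ℝ, hξ⟩)
  have e3 : ∀ᶠ u in 𝓝[>] (0 : ℝ), D.F 1 (h (D.F 0 (u, ξ))) = D.F 0 (u, ξ) := by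
    have h1 := hst.eventually_right_inverse
    rw [hbase] at h1
    exact (hγ.continuousAt.tendsto.eventually h1).filter_mono nhdsWithin_le_nhds
  obtain ⟨u, h1, h2, h3, h4⟩ := (e1.and (e2.and (e3.and
    (Ioo_mem_nhdsGT (zero_lt_one (α := ℝ)))))).exists
  exact disjoint_left.1 D.disjoint_patches
    (mem_image_of_mem (D.F 0) (show (u, ξ) ∈ openSquare from ⟨h4, hξ⟩))
    ⟨_, ⟨⟨h1, h2.1⟩, h2.2⟩, h3⟩

/-! ### Nonvanishing of the gluing scale -/

theorem alpha_eq (lam ξ : ℝ) :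
    D.alpha lam τ ξ = lam * det2 (partialFst (D.F τ) (0, ξ)) D.edge := by
  rw [alpha, partialSnd_F_edge]

theorem continuous_det2 : Continuous fun ξ : ℝ => det2 (partialFst (D.F τ) (0, ξ)) D.edge := by
  simp only [F, partialFst_bilinearMap, det2]
  simp only [PiLp.add_apply, PiLp.smul_apply, smul_eq_mul]
  fun_prop

/-- The functional is a quadratic `c² A + 2 c B + const`. A minimum at `c = 0` forces `B = 0`, but
`B` integrates the difference of two determinants of opposite sign. -/
theorem IsGluingScale.ne_zero {D : TwoPatchDomain} {lam : ℝ} (h : D.IsGluingScale lam) :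
    lam ≠ 0 := by
  rintro rfl
  set a : Fin 2 → ℝ → ℝ := fun τ ξ => det2 (partialFst (D.F τ) (0, ξ)) D.edge with ha
  have hac : ∀ τ, Continuous (a τ) := fun τ => D.continuous_det2 τ
  have hexp : ∀ c b : ℝ, ∀ τ, ∫ ξ in (0 : ℝ)..1, (c * a τ ξ + b) ^ 2
      = c ^ 2 * (∫ ξ in (0 : ℝ)..1, a τ ξ ^ 2) + 2 * c * b * (∫ ξ in (0 : ℝ)..1, a τ ξ) + b ^ 2 := by
    intro c b τ
    have : ∀ ξ, (c * a τ ξ + b) ^ 2 = c ^ 2 * a τ ξ ^ 2 + 2 * c * b * a τ ξ + b ^ 2 := fun ξ => by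
      ring
    simp only [this]
    have := hac τ
    rw [intervalIntegral.integral_add, intervalIntegral.integral_add,
      intervalIntegral.integral_const_mul, intervalIntegral.integral_const_mul]
    · simp
    all_goals exact Continuous.intervalIntegrable (by fun_prop) _ _
  set A := (∫ ξ in (0 : ℝ)..1, a 0 ξ ^ 2) + ∫ ξ in (0 : ℝ)..1, a 1 ξ ^ 2 with hA
  set B := (∫ ξ in (0 : ℝ)..1, a 0 ξ) - ∫ ξ in (0 : ℝ)..1, a 1 ξ with hB
  have hA0 : 0 ≤ A := add_nonneg
    (intervalIntegral.integral_nonneg zero_le_one fun _ _ => sq_nonneg _)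
    (intervalIntegral.integral_nonneg zero_le_one fun _ _ => sq_nonneg _)
  have hmin : ∀ c : ℝ, 0 ≤ c ^ 2 * A + 2 * c * B := by
    intro c
    have h1 := h (mem_univ c)
    simp only [mem_ofPred_eq, alpha_eq, sub_eq_add_neg] at h1
    have e := fun c => hexp c 1 0
    have e' := fun c => hexp c (-1) 1
    simp only [ha] at e e'
    rw [e, e, e', e'] at h1
    simp only [hA, hB, ha]
    linarith
  have hB0 : B = 0 := by
    -- The denominator `A + 1` instead of `A` cannot vanish and still gives a negative value when `B
    -- ≠ 0`.
    have h1 := hmin (-B / (A + 1))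
    have h2 : (-B / (A + 1)) ^ 2 * A + 2 * (-B / (A + 1)) * B
        = -(B ^ 2 * (A + 2)) / (A + 1) ^ 2 := by field_simp; ring
    rw [h2, neg_div, Left.nonneg_neg_iff] at h1
    by_contra hne
    have : 0 < B ^ 2 * (A + 2) / (A + 1) ^ 2 := by positivity
    linarith
  have hpre : IsPreconnected (a 0 '' Icc 0 1) := isPreconnected_Icc.image _ (hac 0).continuousOn
  have hsub : B = ∫ ξ in (0 : ℝ)..1, (a 0 ξ - a 1 ξ) :=
    (intervalIntegral.integral_sub ((hac 0).intervalIntegrable _ _)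
      ((hac 1).intervalIntegrable _ _)).symm
  have hint : IntervalIntegrable (fun ξ => a 0 ξ - a 1 ξ) volume 0 1 :=
    ((hac 0).sub (hac 1)).intervalIntegrable _ _
  have hne : ∀ ξ ∈ Icc (0 : ℝ) 1, a 0 ξ ≠ 0 := fun ξ hξ => D.det2_ne_zero 0 hξ
  have hord := hpre.ordConnected
  have hzero : (0 : ℝ) ∉ a 0 '' Icc 0 1 := by rintro ⟨ξ, hξ, h0⟩; exact hne ξ hξ h0
  have hm : (2⁻¹ : ℝ) ∈ Icc (0 : ℝ) 1 := by constructor <;> norm_num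
  rcases lt_or_gt_of_ne (hne _ hm) with hs | hs
  -- The determinant of patch `0` has no zero on the connected interval, so it keeps its sign at
  -- `1/2`.
  · have hall : ∀ ξ ∈ Icc (0 : ℝ) 1, a 0 ξ < 0 := fun ξ hξ => by
      by_contra hcon
      exact hzero (hord.out (mem_image_of_mem _ hm) (mem_image_of_mem _ hξ)
        ⟨hs.le, not_lt.1 hcon⟩)
    have := intervalIntegral.intervalIntegral_pos_of_pos_on hint.neg (fun ξ hξ => by
      have h1 := hall ξ (Ioo_subset_Icc_self hξ)
      have h2 : 0 < a 1 ξ := pos_of_mul_neg_right (D.det2_mul_det2_neg hξ) h1.le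
      simp only [Pi.neg_apply]; linarith) zero_lt_one
    simp only [Pi.neg_apply, intervalIntegral.integral_neg] at this
    linarith
  · have hall : ∀ ξ ∈ Icc (0 : ℝ) 1, 0 < a 0 ξ := fun ξ hξ => by
      by_contra hcon
      exact hzero (hord.out (mem_image_of_mem _ hξ) (mem_image_of_mem _ hm)
        ⟨not_lt.1 hcon, hs.le⟩)
    have := intervalIntegral.intervalIntegral_pos_of_pos_on hint (fun ξ hξ => by
      have h1 := hall ξ (Ioo_subset_Icc_self hξ)
      have h2 : a 1 ξ < 0 := neg_of_mul_neg_right (D.det2_mul_det2_neg hξ) h1.le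
      linarith) zero_lt_one
    linarith

end TwoPatchDomain

/-! ### Interface functions as normal derivatives -/

namespace TwoPatchDomain

variable (D : TwoPatchDomain)

theorem edge_ne_zero : D.edge ≠ 0 := by
  intro h
  have := D.det2_ne_zero 0 (ξ := 0) (by simp)
  rw [h] at this
  simp [det2] at this

/-- The vector normal to the common edge for which `∂₁F = α • normal + β • edge` on the edge. -/
def normal (lam : ℝ) : Plane := (lam * ‖D.edge‖ ^ 2)⁻¹ • !₂[D.edge 1, -D.edge 0]

theorem norm_edge_sq : ‖D.edge‖ ^ 2 = D.edge 0 ^ 2 + D.edge 1 ^ 2 := by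
  simp [EuclideanSpace.norm_sq_eq]

/-- The coefficient of `edge` is the orthogonal projection `β`. The scaling of `normal` gives `det2
normal edge = 1/λ`, so the other coefficient is `α`. -/
theorem partialFst_F_eq {lam : ℝ} (hlam : lam ≠ 0) (τ : Fin 2) (ξ : ℝ) :
    partialFst (D.F τ) (0, ξ) = D.alpha lam τ ξ • D.normal lam + D.beta τ ξ • D.edge := by
  have he : ‖D.edge‖ ^ 2 ≠ 0 := by simpa using D.edge_ne_zero
  have hn := D.norm_edge_sq
  rw [hn] at he
  rw [alpha_eq, beta, partialSnd_F_edge, normal, hn]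
  set d := partialFst (D.F τ) (0, ξ)
  rw [PiLp.inner_apply, Fin.sum_univ_two]
  ext k
  fin_cases k
  · simp [det2]
    field_simp
    ring
  · simp [det2]
    field_simp
    ring

theorem det2_normal_edge_ne_zero {lam : ℝ} (hlam : lam ≠ 0) : det2 (D.normal lam) D.edge ≠ 0 := by
  have h := D.det2_ne_zero 0 (ξ := 0) (by simp)
  rw [D.partialFst_F_eq hlam, det2_smul_add_smul] at h
  exact right_ne_zero_of_mul h

/-- The basis of the plane formed by the edge direction and the normal vector. -/
theorem exists_basis_edge_normal {lam : ℝ} (hlam : lam ≠ 0) :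
    ∃ b : Module.Basis (Fin 2) ℝ Plane, b 0 = D.edge ∧ b 1 = D.normal lam := by
  have hli : LinearIndependent ℝ ![D.edge, D.normal lam] := by
    rw [LinearIndependent.pair_iff]
    intro a b hab
    rw [add_comm] at hab
    exact (eq_zero_of_smul_add_smul_eq_zero (D.det2_normal_edge_ne_zero hlam) hab).symm
  exact ⟨basisOfLinearIndependentOfCardEqFinrank hli (by simp), by simp, by simp⟩

theorem edge_point_mem (τ : Fin 2) {ξ : ℝ} (hξ : ξ ∈ Icc (0 : ℝ) 1) :
    D.corner 0 0 0 + ξ • D.edge ∈ D.closedPatch τ :=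
  ⟨(0, ξ), ⟨by simp, hξ⟩, D.F_zero τ ξ⟩

theorem alpha_ne_zero {lam : ℝ} (hlam : lam ≠ 0) (τ : Fin 2) {ξ : ℝ} (hξ : ξ ∈ Icc (0 : ℝ) 1) :
    D.alpha lam τ ξ ≠ 0 := by
  rw [alpha_eq]
  exact mul_ne_zero hlam (D.det2_ne_zero τ hξ)

theorem iteratedFDerivWithin_comp_perm_closedPatch {s m : ℕ} {τ : Fin 2} {G : Plane → ℝ}
    (hG : ContDiffOn ℝ s G (D.closedPatch τ)) (hm : m ≤ s) {x : Plane} (hx : x ∈ D.closedPatch τ)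
    (v : Fin m → Plane) (σ : Equiv.Perm (Fin m)) :
    iteratedFDerivWithin ℝ m G (D.closedPatch τ) x (v ∘ σ)
      = iteratedFDerivWithin ℝ m G (D.closedPatch τ) x v :=
  iteratedFDerivWithin_comp_perm_of_contDiffOn (D.uniqueDiffOn_closedPatch τ)
    (D.closedPatch_subset_closure_interior τ) m (hG.of_le (by exact_mod_cast hm)) x hx v σ

/-- If the lower order interface functions are the normal derivatives of `f ∘ F⁻¹` along the common
edge, then so is the interface function of order `l`. -/
theorem interfaceFun_eq_iteratedFDerivWithin {s l : ℕ} {lam : ℝ} (hlam : lam ≠ 0) (τ : Fin 2)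
    {f : ℝ × ℝ → ℝ} (hG : ContDiffOn ℝ s (f ∘ D.invF τ) (D.closedPatch τ)) {g : ℕ → ℝ → ℝ}
    (hl : l ≤ s)
    (hg : ∀ i < l, ∀ ξ ∈ Icc (0 : ℝ) 1, g i ξ = iteratedFDerivWithin ℝ i (f ∘ D.invF τ)
      (D.closedPatch τ) (D.corner 0 0 0 + ξ • D.edge) fun _ => D.normal lam)
    {ξ : ℝ} (hξ : ξ ∈ Icc (0 : ℝ) 1) :
    D.interfaceFun lam τ f g l ξ = iteratedFDerivWithin ℝ l (f ∘ D.invF τ)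
      (D.closedPatch τ) (D.corner 0 0 0 + ξ • D.edge) fun _ => D.normal lam := by
  have hu := D.uniqueDiffOn_closedPatch τ
  have hα := D.alpha_ne_zero hlam τ hξ
  set G := f ∘ D.invF τ with hGdef
  set P := D.closedPatch τ
  set x := D.corner 0 0 0 + ξ • D.edge with hx
  set n := D.normal lam
  set α := D.alpha lam τ ξ
  set β := D.beta τ ξ
  -- Because `t ↦ F (t, ξ)` is affine, the chain rule has no terms of lower order.
  have h1 : iteratedDerivWithin l (fun t => f (t, ξ)) (Icc 0 1) 0
      = α ^ l * iteratedFDerivWithin ℝ l G P x fun _ => n + (β / α) • D.edge := by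
    have hline : ∀ t ∈ Icc (0 : ℝ) 1, x + t • partialFst (D.F τ) (0, ξ) ∈ P := fun t ht =>
      ⟨(t, ξ), ⟨ht, hξ⟩, D.F_eq τ t ξ⟩
    have hcongr : EqOn (fun t => f (t, ξ))
        (fun t => G (x + t • partialFst (D.F τ) (0, ξ))) (Icc 0 1) := fun t ht => by
      simp only [hGdef, Function.comp_apply, hx, ← D.F_eq]
      rw [D.invF_F τ ⟨ht, hξ⟩]
    have h0 : (0 : ℝ) ∈ Icc (0 : ℝ) 1 := by simp
    rw [iteratedDerivWithin_congr hcongr h0,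
      iteratedDerivWithin_along (hG.of_le (by exact_mod_cast hl)) hu hline h0, zero_smul, add_zero]
    have hd : partialFst (D.F τ) (0, ξ) = α • (n + (β / α) • D.edge) := by
      rw [D.partialFst_F_eq hlam, smul_add, smul_smul, mul_div_cancel₀ _ hα]
    rw [hd]
    have := (iteratedFDerivWithin ℝ l G P x).map_smul_univ (fun _ => α)
      (fun _ => n + (β / α) • D.edge)
    simpa using this
  have hdir : ∀ i ∈ Finset.range l, iteratedDerivWithin (l - i) (g i) (Icc 0 1) ξ
      = iteratedFDerivWithin ℝ l G P x (mixedDirections D.edge n l i) := by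
    intro i hi
    obtain ⟨j, rfl⟩ := Nat.exists_eq_add_of_le (Finset.mem_range.1 hi).le
    rw [iteratedDerivWithin_congr (hg i (Finset.mem_range.1 hi)) hξ, Nat.add_sub_cancel_left,
      iteratedDerivWithin_iteratedFDerivWithin_along (hG.of_le (by exact_mod_cast hl)) hu
        (fun t ht => D.edge_point_mem τ ht) hξ]
  -- The terms `i < l` of the binomial expansion cancel the subtracted sum; the term `i = l` is the
  -- pure normal derivative.
  rw [interfaceFun, Finset.sum_congr rfl fun i hi => congrArg (_ * ·) (hdir i hi), h1,
    map_add_smul_of_symmetric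
    (D.iteratedFDerivWithin_comp_perm_closedPatch hG hl (D.edge_point_mem τ hξ)),
    Finset.sum_range_succ, mixedDirections_self, zpow_neg, zpow_natCast,
    inv_mul_cancel_left₀ (pow_ne_zero _ hα)]
  simp [α, β, P, x]

theorem closedPatch_inter :
    D.closedPatch 0 ∩ D.closedPatch 1
      = (fun ξ : ℝ => D.corner 0 0 0 + ξ • D.edge) '' Icc 0 1 :=
  D.inter_eq.trans (image_congr fun ξ _ => D.F_zero 0 ξ)

theorem closedPatch_subset_closedDomain (τ : Fin 2) : D.closedPatch τ ⊆ D.closedDomain := by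
  fin_cases τ
  · exact subset_union_left
  · exact subset_union_right

theorem uniqueDiffOn_closedDomain : UniqueDiffOn ℝ D.closedDomain := by
  rintro x (hx | hx)
  · exact (D.uniqueDiffOn_closedPatch 0 x hx).mono subset_union_left
  · exact (D.uniqueDiffOn_closedPatch 1 x hx).mono subset_union_right

theorem iteratedFDerivWithin_eq_of_normal_eq {s m : ℕ} {lam : ℝ} (hlam : lam ≠ 0)
    {G : Fin 2 → Plane → ℝ} (hG : ∀ τ, ContDiffOn ℝ s (G τ) (D.closedPatch τ)) {g : ℕ → ℝ → ℝ}
    (hg : ∀ τ, ∀ i ≤ s, ∀ ξ ∈ Icc (0 : ℝ) 1, g i ξ = iteratedFDerivWithin ℝ i (G τ)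
      (D.closedPatch τ) (D.corner 0 0 0 + ξ • D.edge) fun _ => D.normal lam)
    (hm : m ≤ s) {ξ : ℝ} (hξ : ξ ∈ Icc (0 : ℝ) 1) :
    iteratedFDerivWithin ℝ m (G 0) (D.closedPatch 0) (D.corner 0 0 0 + ξ • D.edge)
      = iteratedFDerivWithin ℝ m (G 1) (D.closedPatch 1) (D.corner 0 0 0 + ξ • D.edge) := by
  obtain ⟨b, hb0, hb1⟩ := D.exists_basis_edge_normal hlam
  refine eq_of_symmetric_of_mixedDirections
    (D.iteratedFDerivWithin_comp_perm_closedPatch (hG 0) hm (D.edge_point_mem 0 hξ))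
    (D.iteratedFDerivWithin_comp_perm_closedPatch (hG 1) hm (D.edge_point_mem 1 hξ)) b
    fun i hi => ?_
  rw [hb0, hb1]
  obtain ⟨j, rfl⟩ := Nat.exists_eq_add_of_le hi
  -- The left side does not involve the patch.
  have key : ∀ τ, iteratedDerivWithin j (g i) (Icc 0 1) ξ
      = iteratedFDerivWithin ℝ (i + j) (G τ) (D.closedPatch τ) (D.corner 0 0 0 + ξ • D.edge)
        (mixedDirections D.edge (D.normal lam) (i + j) i) := fun τ => by
    rw [iteratedDerivWithin_congr (hg τ i (by omega)) hξ,
      iteratedDerivWithin_iteratedFDerivWithin_along ((hG τ).of_le (by exact_mod_cast hm))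
        (D.uniqueDiffOn_closedPatch τ) (fun t ht => D.edge_point_mem τ ht) hξ]
  rw [← key 0, ← key 1]

end TwoPatchDomain

end Isogeometric

end

/-- The sequence `g` carries the common values `f_ℓ`. As `interfaceFun` at order `l` sees only `g i`
with `i < l`, its existence encodes the recursion. -/
theorem theorem2 (p r k s : ℕ) (hs : 1 ≤ s) (hp : 2 * s + 1 ≤ p) (hsr : s ≤ r)
    (hrp : r + (s + 1) ≤ p) (D : Isogeometric.TwoPatchDomain) (lam : ℝ)
    (hlam : D.IsGluingScale lam) (φ : D.L2) (hφ : φ ∈ D.isogeometricSpace p r k)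
    (f : Fin 2 → ℝ × ℝ → ℝ) (hf : ∀ τ, D.IsSplineOn p r k φ τ (f τ)) :
    φ ∈ D.smoothIsogeometricSpace p r k s ↔
      ∃ g : ℕ → ℝ → ℝ, ∀ l ≤ s, ∀ ξ ∈ Set.Icc (0 : ℝ) 1,
        D.interfaceFun lam 0 (f 0) g l ξ = g l ξ ∧ D.interfaceFun lam 1 (f 1) g l ξ = g l ξ := by
  classical
  have hlam0 : lam ≠ 0 := hlam.ne_zero
  have hG : ∀ τ, ContDiffOn ℝ s (f τ ∘ D.invF τ) (D.closedPatch τ) := fun τ =>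
    (D.contDiffOn_comp_invF τ (hf τ).1).of_le (by exact_mod_cast hsr)
  have hclosed : ∀ τ, IsClosed (D.closedPatch τ) := fun τ => (D.isCompact_closedPatch τ).isClosed
  constructor
  · rintro ⟨-, g, hg, hφg⟩
    -- Two continuous functions equal almost everywhere agree on a set that lies in the closure of
    -- its interior.
    have heq : ∀ τ, EqOn (f τ ∘ D.invF τ) g (D.closedPatch τ) := fun τ =>
      Measure.eqOn_of_ae_eq ((hf τ).2.symm.trans
        (ae_restrict_of_ae_restrict_of_subset (D.closedPatch_subset_closedDomain τ) hφg))
        (hG τ).continuousOn (hg.continuousOn.mono (D.closedPatch_subset_closedDomain τ))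
        (D.closedPatch_subset_closure_interior τ)
    have hder : ∀ τ, ∀ l ≤ s, ∀ ξ ∈ Icc (0 : ℝ) 1,
        iteratedFDerivWithin ℝ l g D.closedDomain (D.corner 0 0 0 + ξ • D.edge)
          = iteratedFDerivWithin ℝ l (f τ ∘ D.invF τ) (D.closedPatch τ)
            (D.corner 0 0 0 + ξ • D.edge) := fun τ l hl ξ hξ => by
      rw [iteratedFDerivWithin_congr (heq τ) (D.edge_point_mem τ hξ),
        iteratedFDerivWithin_eq_of_contDiffOn_superset (D.uniqueDiffOn_closedPatch τ)
          D.uniqueDiffOn_closedDomain (D.closedPatch_subset_closedDomain τ) hg hl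
          (D.edge_point_mem τ hξ)]
    refine ⟨fun l ξ => iteratedFDerivWithin ℝ l g D.closedDomain (D.corner 0 0 0 + ξ • D.edge)
      fun _ => D.normal lam, fun l hl ξ hξ => ?_⟩
    have h : ∀ τ, D.interfaceFun lam τ (f τ) (fun l ξ => iteratedFDerivWithin ℝ l g D.closedDomain
        (D.corner 0 0 0 + ξ • D.edge) fun _ => D.normal lam) l ξ
        = iteratedFDerivWithin ℝ l g D.closedDomain (D.corner 0 0 0 + ξ • D.edge)
          fun _ => D.normal lam := fun τ => by
      rw [D.interfaceFun_eq_iteratedFDerivWithin hlam0 τ (hG τ) hl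
        (fun i hi ζ hζ => by rw [hder τ i (by omega) ζ hζ]) hξ, hder τ l hl ξ hξ]
    exact ⟨h 0, h 1⟩
  · rintro ⟨g, hg⟩
    have hnormal : ∀ i, i ≤ s → ∀ τ, ∀ ξ ∈ Icc (0 : ℝ) 1, g i ξ
        = iteratedFDerivWithin ℝ i (f τ ∘ D.invF τ) (D.closedPatch τ)
          (D.corner 0 0 0 + ξ • D.edge) fun _ => D.normal lam := by
      intro i
      induction i using Nat.strong_induction_on with
      | _ i ih =>
        intro hi τ ξ hξ
        rw [← D.interfaceFun_eq_iteratedFDerivWithin hlam0 τ (hG τ) hi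
          (fun j hj => ih j hj (by omega) τ) hξ]
        fin_cases τ
        · exact (hg i hi ξ hξ).1.symm
        · exact (hg i hi ξ hξ).2.symm
    have hder : ∀ m ≤ s, ∀ ξ ∈ Icc (0 : ℝ) 1, _ := fun m hm ξ hξ =>
      D.iteratedFDerivWithin_eq_of_normal_eq hlam0 hG (fun τ i hi => hnormal i hi τ) hm hξ
    set G : Isogeometric.Plane → ℝ :=
      (D.closedPatch 0).piecewise (f 0 ∘ D.invF 0) (f 1 ∘ D.invF 1) with hGdef
    have e0 : EqOn G (f 0 ∘ D.invF 0) (D.closedPatch 0) := piecewise_eqOn _ _ _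
    have e1 : EqOn G (f 1 ∘ D.invF 1) (D.closedPatch 1) := by
      intro x hx
      by_cases hx0 : x ∈ D.closedPatch 0
      · obtain ⟨ξ, hξ, rfl⟩ := D.closedPatch_inter.subset ⟨hx0, hx⟩
        -- Order `0` of the jet identity: the values agree on the edge, so the piecewise function is
        -- well defined there.
        have := congrArg (fun L => L 0) (hder 0 (Nat.zero_le s) ξ hξ)
        simp only [iteratedFDerivWithin_zero_apply] at this
        exact (e0 hx0).trans this
      · exact piecewise_eq_of_notMem _ _ _ hx0
    refine ⟨hφ, G, contDiffOn_union_of_iteratedFDerivWithin_eq (hclosed 0) (hclosed 1)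
      (D.uniqueDiffOn_closedPatch 0) (D.uniqueDiffOn_closedPatch 1) ((hG 0).congr e0)
      ((hG 1).congr e1) ?_, ?_⟩
    · rintro m hm x hx
      rw [iteratedFDerivWithin_congr e0 hx.1, iteratedFDerivWithin_congr e1 hx.2]
      obtain ⟨ξ, hξ, rfl⟩ := D.closedPatch_inter.subset hx
      exact hder m hm ξ hξ
    · have h0 : (φ : Isogeometric.Plane → ℝ) =ᵐ[volume.restrict (D.closedPatch 0)] G :=
        (hf 0).2.trans ((ae_restrict_of_forall_mem (hclosed 0).measurableSet e0).mono
          fun _ h => h.symm)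
      have h1 : (φ : Isogeometric.Plane → ℝ) =ᵐ[volume.restrict (D.closedPatch 1)] G :=
        (hf 1).2.trans ((ae_restrict_of_forall_mem (hclosed 1).measurableSet e1).mono
          fun _ h => h.symm)
      exact ae_restrict_union_iff _ _ _ |>.2 ⟨h0, h1⟩
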